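/- Let $k\ge 1$ be a fixed integer. For each integer $n\ge 1$ let $\lambda$ be a uniformly random composition of $n$ (an ordered list of positive integers with sum $n$), and let $C_{n,k}$ be the number of parts of $\lambda$ that are equal to $k$. Put $$\mu_{n,k}=\frac{n-k+3}{2^{k+1}},\qquad \sigma^2_{n,k}=\frac{(2^{k+1}-2k+3)\,n+3k(k-4)+(3-k)2^{k+1}+5}{4^{k+1}}.$$ Then $\mathbb{E}[C_{n,k}]=\mu_{n,k}$ for all $n>k$, $\operatorname{Var}(C_{n,k})=\sigma^2_{n,k}$ for all $n>2k$, and $C_{n,k}$ is asymptotically normal: for every $t\in\mathbb{R}$, $$\lim_{n\to\infty}P\left(\frac{C_{n,k}-\mu_{n,k}}{\sigma_{n,k}}<t\right)=\frac1{\sqrt{2\pi}}\int_{-\infty}^t e^{-x^2/2}\,dx .$$ -/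

import Mathlib

open MeasureTheory ProbabilityTheory Filter Topology

/-- Every subset of the finite set of compositions of `n` is an event. -/
instance Composition.instMeasurableSpaceTop (n : ℕ) : MeasurableSpace (Composition n) := ⊤

/-- The uniform probability measure on the compositions of `n`. -/
noncomputable def uniformComposition (n : ℕ) : Measure (Composition n) :=
  uniformOn Set.univ

/-- The number of parts of size `k` (the `k`-parts) of a composition, as a real number. -/
def numParts {n : ℕ} (k : ℕ) (c : Composition n) : ℝ :=
  (c.blocks.count k : ℝ)

/-- `μ_{n,k} = (n - k + 3) / 2^{k+1}`. -/
noncomputable def partsMean (n k : ℕ) : ℝ :=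
  ((n : ℝ) - k + 3) / 2 ^ (k + 1)

/-- `σ²_{n,k} = ((2^{k+1} - 2k + 3) n + 3k(k-4) + (3-k) 2^{k+1} + 5) / 4^{k+1}`. -/
noncomputable def partsVar (n k : ℕ) : ℝ :=
  ((2 ^ (k + 1) - 2 * (k : ℝ) + 3) * n + 3 * (k : ℝ) * ((k : ℝ) - 4)
    + (3 - (k : ℝ)) * 2 ^ (k + 1) + 5) / 4 ^ (k + 1)

/-! Deleting the first block and differencing in `n` gives, for sums S_n(f) over compositions,
S_{n+1}(f) = 2 S_n(f) + S_{n+1-k}(Δf) - S_{n-k}(Δf) when n ≥ k (`compositionSum_succ_of_le`). Since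
Δ lowers degree, f = x and f = x(x-1) yield closed forms for the first two factorial moments, hence
mean and variance.

For f = exp(iθx), Δ is multiplication by exp(iθ) - 1, so ψ_n = S_n(f)/2^n solves a recurrence
perturbed by δ = (exp(iθ) - 1)/2^(k+1). As |ψ_n| ≤ 1, the delays can be expanded: ψ_{n+1} = (1 + δ +
(2-k)δ²) ψ_n + O(δ³) uniformly in n ≥ 3k (`norm_succ_sub_mul_le_of_recurrence`). Up to O(θ³) this
factor is r = exp(iθ/2^(k+1) - vθ²/2), with v the variance rate; |r| ≤ 1, so errors only add up, to
O(mθ³) after m steps. At θ = s/σ this is O(m^(-1/2)), the main term tends to exp(-s²/2), and Lévy's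
continuity theorem concludes. -/

/-! ### Recurrence from the first block. -/

/-- The sum of `f` evaluated at the number of `k`-parts, over all compositions of `n`. -/
def compositionSum {R : Type*} [AddCommMonoid R] (k n : ℕ) (f : ℕ → R) : R :=
  ∑ c : Composition n, f (c.blocks.count k)

/-- Prepend to a composition of `i ≤ n` the block `n + 1 - i`. -/
def Composition.consBlock (n : ℕ) (p : Σ i : Fin (n + 1), Composition i) :
    Composition (n + 1) where
  blocks := (n + 1 - p.1) :: p.2.blocks
  blocks_pos := by
    intro i hi
    rcases List.mem_cons.1 hi with rfl | hi
    · have := p.1.2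
      omega
    · exact p.2.blocks_pos hi
  blocks_sum := by
    have := p.1.2
    simp only [List.sum_cons, Composition.blocks_sum]
    omega

theorem Composition.consBlock_bijective (n : ℕ) :
    Function.Bijective (Composition.consBlock n) := by
  constructor
  · rintro ⟨i, c⟩ ⟨j, d⟩ h
    have h' := congrArg Composition.blocks h
    simp only [Composition.consBlock, List.cons.injEq] at h'
    obtain rfl : i = j := by
      ext
      have := i.2
      have := j.2
      omega
    obtain rfl : c = d := Composition.ext h'.2
    rfl
  · rintro ⟨_ | ⟨a, l⟩, hpos, hsum⟩
    · simp at hsum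
    · have ha : 0 < a := hpos (by simp)
      rw [List.sum_cons] at hsum
      refine ⟨⟨⟨l.sum, by omega⟩, ⟨l, fun h => hpos (by simp [h]), rfl⟩⟩, ?_⟩
      apply Composition.ext
      simp only [Composition.consBlock, List.cons.injEq, and_true]
      omega

theorem compositionSum_zero {R : Type*} [AddCommMonoid R] (k : ℕ) (f : ℕ → R) :
    compositionSum k 0 f = f 0 := by
  have h : Fintype.card (Composition 0) = 1 := by simp [composition_card]
  obtain ⟨c, hc⟩ := Fintype.card_eq_one_iff.1 h
  unfold compositionSum
  rw [Fintype.sum_eq_single c fun d hd => absurd (hc d) hd, ← hc (Composition.ones 0)]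
  simp [Composition.ones]

/-- Split by the first block: what remains is a composition of some i ≤ n, and the count rises by
one exactly when the deleted block is `k`. -/
theorem compositionSum_succ {R : Type*} [AddCommGroup R] {k : ℕ} (n : ℕ) (hk : 1 ≤ k)
    (f : ℕ → R) :
    compositionSum k (n + 1) f = ∑ i ∈ Finset.range (n + 1), compositionSum k i f +
      if k ≤ n + 1 then compositionSum k (n + 1 - k) (fun x => f (x + 1) - f x) else 0 := by
  have h1 : compositionSum k (n + 1) f = ∑ i ∈ Finset.range (n + 1),
      (compositionSum k i f +
        if i + k = n + 1 then compositionSum k i (fun x => f (x + 1) - f x) else 0) := by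
    unfold compositionSum
    rw [← (Composition.consBlock_bijective n).sum_comp, Fintype.sum_sigma,
      ← Fin.sum_univ_eq_sum_range (fun i => ∑ c : Composition i, f (c.blocks.count k) +
        if i + k = n + 1 then ∑ c : Composition i, (f (c.blocks.count k + 1) -
          f (c.blocks.count k)) else 0)]
    refine Finset.sum_congr rfl fun i _ => ?_
    split_ifs with h
    · rw [← Finset.sum_add_distrib]
      refine Finset.sum_congr rfl fun c _ => ?_
      have : n + 1 - (i : ℕ) = k := by omega
      simp [Composition.consBlock, this]
    · rw [add_zero]
      refine Finset.sum_congr rfl fun c _ => ?_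
      have : n + 1 - (i : ℕ) ≠ k := by
        have := i.2
        omega
      simp [Composition.consBlock, List.count_cons_of_ne this]
  rw [h1, Finset.sum_add_distrib]
  congr 1
  split_ifs with h
  · rw [Finset.sum_eq_single (n + 1 - k)]
    · rw [if_pos (by omega)]
    · intro b _ hb
      rw [if_neg (by omega)]
    · intro hb
      simp only [Finset.mem_range] at hb
      omega
  · refine Finset.sum_eq_zero fun i _ => if_neg (by omega)

theorem compositionSum_succ_of_le {R : Type*} [CommRing R] {k n : ℕ} (hk : 1 ≤ k) (hn : k ≤ n)
    (f : ℕ → R) :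
    compositionSum k (n + 1) f = 2 * compositionSum k n f +
      compositionSum k (n + 1 - k) (fun x => f (x + 1) - f x) -
      compositionSum k (n - k) (fun x => f (x + 1) - f x) := by
  obtain ⟨m, rfl⟩ : ∃ m, n = m + 1 := ⟨n - 1, by omega⟩
  rw [compositionSum_succ _ hk, Finset.sum_range_succ, if_pos (by omega)]
  have h := compositionSum_succ m hk f
  rw [if_pos (by omega)] at h
  linear_combination -h

theorem compositionSum_of_lt {R : Type*} [CommRing R] {k n : ℕ} (hn : n < k) (f : ℕ → R) :
    compositionSum k n f = 2 ^ (n - 1) * f 0 := by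
  unfold compositionSum
  have (c : Composition n) : c.blocks.count k = 0 :=
    List.count_eq_zero.2 fun h => absurd (c.blocks_le h) (by omega)
  simp [this, composition_card]

theorem compositionSum_self {R : Type*} [CommRing R] {k : ℕ} (hk : 1 ≤ k) (f : ℕ → R) :
    compositionSum k k f = (2 ^ (k - 1) - 1) * f 0 + f 1 := by
  obtain ⟨m, rfl⟩ : ∃ m, k = m + 1 := ⟨k - 1, by omega⟩
  have h1 := compositionSum_succ (k := m + 1) m hk f
  -- No composition of m + 1 has a part m + 2, so this instance computes the sum over smaller
  -- compositions that `h1` also contains.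
  have h2 := compositionSum_succ (k := m + 2) m (by omega) f
  rw [compositionSum_of_lt (by omega), if_neg (by omega)] at h2
  rw [if_pos le_rfl, Nat.sub_self, compositionSum_zero] at h1
  have h3 : ∑ i ∈ Finset.range (m + 1), compositionSum (m + 1) i f =
      ∑ i ∈ Finset.range (m + 1), compositionSum (m + 2) i f := by
    refine Finset.sum_congr rfl fun i hi => ?_
    have := Finset.mem_range.1 hi
    rw [compositionSum_of_lt (by omega), compositionSum_of_lt (by omega)]
  rw [h1, h3]
  linear_combination -h2

theorem compositionSum_const {R : Type*} [CommRing R] (k n : ℕ) (a : R) :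
    compositionSum k n (fun _ => a) = 2 ^ (n - 1) * a := by
  simp [compositionSum, composition_card]

theorem compositionSum_const_mul {R : Type*} [CommRing R] (k n : ℕ) (a : R) (f : ℕ → R) :
    compositionSum k n (fun x => a * f x) = a * compositionSum k n f := by
  simp [compositionSum, Finset.mul_sum]

theorem compositionSum_add {R : Type*} [CommRing R] (k n : ℕ) (f g : ℕ → R) :
    compositionSum k n (fun x => f x + g x) = compositionSum k n f + compositionSum k n g := by
  simp [compositionSum, Finset.sum_add_distrib]

/-! ### Closed forms for the factorial moments. -/

/-- At n = k the truncated exponent gives 2^0 = 1, which correctly counts the empty composition. -/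
theorem compositionSum_id_succ {k n : ℕ} (hk : 1 ≤ k) (hn : k ≤ n) :
    compositionSum k (n + 1) (fun x => (x : ℝ)) = 2 * compositionSum k n (fun x => (x : ℝ)) +
      2 ^ (n - k) - 2 ^ (n - k - 1) := by
  rw [compositionSum_succ_of_le hk hn]
  simp only [Nat.cast_add, Nat.cast_one, add_sub_cancel_left]
  rw [compositionSum_const, compositionSum_const, show n + 1 - k - 1 = n - k by omega]
  ring

theorem compositionSum_id {k : ℕ} (hk : 1 ≤ k) (m : ℕ) :
    compositionSum k (k + 1 + m) (fun x => (x : ℝ)) = (m + 4) * 2 ^ m / 2 := by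
  induction m with
  | zero =>
    rw [add_zero, compositionSum_id_succ hk le_rfl, compositionSum_self hk]
    simp
    norm_num
  | succ m ih =>
    rw [← add_assoc, compositionSum_id_succ hk (by omega), ih, show k + 1 + m - k = m + 1 by omega]
    rw [Nat.add_sub_cancel, pow_succ]
    push_cast
    ring

/-- The falling factorial `x (x - 1)` as a real number. -/
def fallingTwo (x : ℕ) : ℝ := x * (x - 1)

theorem compositionSum_fallingTwo_succ {k n : ℕ} (hk : 1 ≤ k) (hn : k ≤ n) :
    compositionSum k (n + 1) fallingTwo = 2 * compositionSum k n fallingTwo +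
      2 * compositionSum k (n + 1 - k) (fun x => (x : ℝ)) -
      2 * compositionSum k (n - k) (fun x => (x : ℝ)) := by
  have h : (fun x : ℕ => fallingTwo (x + 1) - fallingTwo x) = fun x : ℕ => 2 * (x : ℝ) := by
    ext x
    simp only [fallingTwo]
    push_cast
    ring
  rw [compositionSum_succ_of_le hk hn, h, compositionSum_const_mul, compositionSum_const_mul]

/-- Two parts equal to `k` do not fit in a total below 2k. -/
theorem compositionSum_fallingTwo_of_lt {k m : ℕ} (hm : m < k) :
    compositionSum k (k + m) fallingTwo = 0 := by
  induction m with
  | zero => rw [add_zero, compositionSum_self (by omega)]; simp [fallingTwo]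
  | succ m ih =>
    rw [← add_assoc, compositionSum_fallingTwo_succ (by omega) (by omega), ih (by omega),
      compositionSum_of_lt (by omega), compositionSum_of_lt (by omega)]
    simp

theorem compositionSum_fallingTwo {k : ℕ} (hk : 1 ≤ k) (m : ℕ) :
    compositionSum k (2 * k + 1 + m) fallingTwo = ((m : ℝ) ^ 2 + 11 * m + 24) * 2 ^ m / 4 := by
  have h0 : compositionSum k (2 * k) fallingTwo = 2 := by
    obtain ⟨j, rfl⟩ : ∃ j, k = j + 1 := ⟨k - 1, by omega⟩
    rw [show 2 * (j + 1) = (j + 1 + j) + 1 by ring, compositionSum_fallingTwo_succ hk (by omega),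
      compositionSum_fallingTwo_of_lt (by omega), compositionSum_of_lt (n := j + 1 + j - (j + 1))
      (by omega), show j + 1 + j + 1 - (j + 1) = j + 1 by omega, compositionSum_self hk]
    simp
  induction m with
  | zero =>
    have h1 := compositionSum_id hk 0
    rw [add_zero] at h1
    rw [add_zero, compositionSum_fallingTwo_succ hk (by omega), h0,
      show 2 * k + 1 - k = k + 1 by omega, show 2 * k - k = k by omega, h1,
      compositionSum_self hk]
    norm_num
  | succ m ih =>
    rw [← add_assoc, compositionSum_fallingTwo_succ hk (by omega), ih,
      show 2 * k + 1 + m + 1 - k = k + 1 + (m + 1) by omega,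
      show 2 * k + 1 + m - k = k + 1 + m by omega, compositionSum_id hk, compositionSum_id hk]
    push_cast
    rw [pow_succ]
    ring

/-! ### Exact mean and variance. -/

instance isProbabilityMeasure_uniformComposition (n : ℕ) :
    IsProbabilityMeasure (uniformComposition n) :=
  isProbabilityMeasure_uniformOn Set.finite_univ ⟨Composition.ones n, trivial⟩

theorem uniformComposition_real_singleton (n : ℕ) (c : Composition n) :
    (uniformComposition n).real {c} = 1 / 2 ^ (n - 1) := by
  rw [measureReal_def, uniformComposition, uniformOn_univ]
  simp [composition_card]

theorem integral_uniformComposition {E : Type*} [NormedAddCommGroup E] [NormedSpace ℝ E]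
    [CompleteSpace E] (k n : ℕ) (f : ℕ → E) :
    ∫ c : Composition n, f (c.blocks.count k) ∂(uniformComposition n) =
      (1 / 2 ^ (n - 1) : ℝ) • compositionSum k n f := by
  rw [integral_fintype .of_finite]
  simp_rw [uniformComposition_real_singleton]
  rw [← Finset.smul_sum]
  rfl

theorem integral_numParts {k n : ℕ} (hk : 1 ≤ k) (hn : k < n) :
    ∫ c, numParts k c ∂(uniformComposition n) = partsMean n k := by
  refine (integral_uniformComposition k n (fun x => (x : ℝ))).trans ?_
  obtain ⟨m, rfl⟩ : ∃ m, n = k + 1 + m := ⟨n - (k + 1), by omega⟩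
  rw [compositionSum_id hk, partsMean, show k + 1 + m - 1 = k + m by omega, smul_eq_mul]
  push_cast
  field_simp
  ring

theorem variance_numParts {k n : ℕ} (hk : 1 ≤ k) (hn : 2 * k < n) :
    variance (fun c : Composition n => numParts k c) (uniformComposition n) = partsVar n k := by
  rw [variance_eq_sub .of_discrete, integral_numParts hk (by omega)]
  have h : ∫ c : Composition n, (numParts k c) ^ 2 ∂(uniformComposition n) =
      (1 / 2 ^ (n - 1) : ℝ) * (compositionSum k n fallingTwo +
        compositionSum k n (fun x => (x : ℝ))) := by
    rw [← compositionSum_add]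
    refine Eq.trans ?_ (integral_uniformComposition k n (fun x => fallingTwo x + (x : ℝ)))
    refine integral_congr_ae (.of_forall fun c => ?_)
    simp only [numParts, fallingTwo]
    ring
  simp only [Pi.pow_apply]
  rw [h]
  obtain ⟨m, rfl⟩ : ∃ m, n = 2 * k + 1 + m := ⟨n - (2 * k + 1), by omega⟩
  rw [compositionSum_fallingTwo hk, show 2 * k + 1 + m = k + 1 + (k + m) by ring,
    compositionSum_id hk, partsMean, partsVar, show k + 1 + (k + m) - 1 = 2 * k + m by omega]
  have h4 : (4 : ℝ) ^ (k + 1) = 4 * (2 ^ k) ^ 2 := by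
    rw [← pow_mul, mul_comm k 2, pow_mul, pow_succ]
    norm_num [mul_comm]
  rw [h4, pow_succ, pow_add _ (2 * k) m, mul_comm 2 k, pow_mul, pow_add]
  push_cast
  field_simp
  ring

/-! ### Bounded solutions of the delayed recurrence. -/

section PerturbedRecurrence

variable {ψ : ℕ → ℂ} {δ : ℂ} {k : ℕ}

theorem norm_succ_sub_le_of_recurrence (hψ : ∀ n, ‖ψ n‖ ≤ 1)
    (hrec : ∀ n, k ≤ n → ψ (n + 1) = ψ n + δ * (2 * ψ (n + 1 - k) - ψ (n - k)))
    {n : ℕ} (hn : k ≤ n) : ‖ψ (n + 1) - ψ n‖ ≤ 3 * ‖δ‖ := by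
  rw [hrec n hn, add_sub_cancel_left, norm_mul]
  have h : ‖2 * ψ (n + 1 - k) - ψ (n - k)‖ ≤ 3 := by
    refine (norm_sub_le _ _).trans ?_
    rw [norm_mul, Complex.norm_ofNat]
    linarith [hψ (n + 1 - k), hψ (n - k)]
  nlinarith [norm_nonneg δ]

theorem norm_add_sub_le_of_recurrence (hψ : ∀ n, ‖ψ n‖ ≤ 1)
    (hrec : ∀ n, k ≤ n → ψ (n + 1) = ψ n + δ * (2 * ψ (n + 1 - k) - ψ (n - k)))
    {n : ℕ} (hn : k ≤ n) (j : ℕ) : ‖ψ (n + j) - ψ n‖ ≤ 3 * j * ‖δ‖ := by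
  induction j with
  | zero => simp
  | succ j ih =>
    have h1 := norm_succ_sub_le_of_recurrence hψ hrec (n := n + j) (by omega)
    have h2 := norm_add_le (ψ (n + j + 1) - ψ (n + j)) (ψ (n + j) - ψ n)
    rw [sub_add_sub_cancel] at h2
    rw [← add_assoc]
    push_cast
    linarith

theorem norm_succ_sub_sub_le_of_recurrence (hk : 1 ≤ k) (hψ : ∀ n, ‖ψ n‖ ≤ 1)
    (hrec : ∀ n, k ≤ n → ψ (n + 1) = ψ n + δ * (2 * ψ (n + 1 - k) - ψ (n - k)))
    {n : ℕ} (hn : 2 * k ≤ n) : ‖ψ (n + 1) - ψ n - δ * ψ n‖ ≤ 9 * k * ‖δ‖ ^ 2 := by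
  have h1 := norm_add_sub_le_of_recurrence hψ hrec (n := n - k) (by omega) k
  have h2 := norm_add_sub_le_of_recurrence hψ hrec (n := n + 1 - k) (by omega) (k - 1)
  rw [show n - k + k = n by omega] at h1
  rw [show n + 1 - k + (k - 1) = n by omega, Nat.cast_sub hk] at h2
  have h3 : ψ (n + 1) - ψ n - δ * ψ n =
      δ * ((ψ n - ψ (n - k)) - 2 * (ψ n - ψ (n + 1 - k))) := by
    rw [hrec n (by omega)]
    ring
  have h4 := norm_sub_le (ψ n - ψ (n - k)) (2 * (ψ n - ψ (n + 1 - k)))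
  rw [norm_mul, Complex.norm_ofNat] at h4
  rw [h3, norm_mul]
  have h5 : ‖ψ n - ψ (n - k) - 2 * (ψ n - ψ (n + 1 - k))‖ ≤ 9 * k * ‖δ‖ := by
    push_cast at h2
    linarith [norm_nonneg δ]
  calc _ ≤ ‖δ‖ * (9 * k * ‖δ‖) := by gcongr
    _ = _ := by ring

/-- The drift is expressed through the endpoint ψ (n + j), so that delayed values can later be
written in terms of the current one. Each step costs 9k for the one-step error and 3k for moving the
endpoint. -/
theorem norm_add_sub_sub_le_of_recurrence (hk : 1 ≤ k) (hψ : ∀ n, ‖ψ n‖ ≤ 1)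
    (hrec : ∀ n, k ≤ n → ψ (n + 1) = ψ n + δ * (2 * ψ (n + 1 - k) - ψ (n - k)))
    {n : ℕ} (hn : 2 * k ≤ n) {j : ℕ} (hj : j ≤ k) :
    ‖ψ (n + j) - ψ n - j * δ * ψ (n + j)‖ ≤ 12 * k * j * ‖δ‖ ^ 2 := by
  induction j with
  | zero => simp
  | succ j ih =>
    have h0 := ih (by omega)
    have h1 := norm_succ_sub_sub_le_of_recurrence hk hψ hrec (n := n + j) (by omega)
    have h2 := norm_succ_sub_le_of_recurrence hψ hrec (n := n + j) (by omega)
    have h3 : ψ (n + j + 1) - ψ n - ((j + 1 : ℕ) : ℂ) * δ * ψ (n + j + 1) =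
        (ψ (n + j + 1) - ψ (n + j) - δ * ψ (n + j)) +
        (ψ (n + j) - ψ n - j * δ * ψ (n + j)) -
        ((j + 1 : ℕ) : ℂ) * δ * (ψ (n + j + 1) - ψ (n + j)) := by
      push_cast
      ring
    have h4 : ‖((j + 1 : ℕ) : ℂ) * δ * (ψ (n + j + 1) - ψ (n + j))‖ ≤ k * ‖δ‖ * (3 * ‖δ‖) := by
      rw [norm_mul, norm_mul, Complex.norm_natCast]
      gcongr
    push_cast at h4
    rw [← add_assoc, h3]
    refine (norm_sub_le _ _).trans ?_
    have h5 := norm_add_le (ψ (n + j + 1) - ψ (n + j) - δ * ψ (n + j))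
      (ψ (n + j) - ψ n - j * δ * ψ (n + j))
    push_cast
    linarith

/-- Insert ψ (n - k) ≈ (1 - kδ) ψ n and ψ (n + 1 - k) ≈ (1 - (k-1)δ) ψ n: the bracket becomes (1 +
(2-k)δ) ψ n. Looking back `k` steps from n ≥ 3k stays in the range n ≥ 2k of the second-order
estimate. -/
theorem norm_succ_sub_mul_le_of_recurrence (hk : 1 ≤ k) (hψ : ∀ n, ‖ψ n‖ ≤ 1)
    (hrec : ∀ n, k ≤ n → ψ (n + 1) = ψ n + δ * (2 * ψ (n + 1 - k) - ψ (n - k)))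
    {n : ℕ} (hn : 3 * k ≤ n) :
    ‖ψ (n + 1) - (1 + δ + (2 - k) * δ ^ 2) * ψ n‖ ≤ 36 * k ^ 2 * ‖δ‖ ^ 3 := by
  have h1 := norm_add_sub_sub_le_of_recurrence hk hψ hrec (n := n - k) (by omega) le_rfl
  have h2 := norm_add_sub_sub_le_of_recurrence hk hψ hrec (n := n + 1 - k) (by omega)
    (j := k - 1) (by omega)
  rw [show n - k + k = n by omega] at h1
  rw [show n + 1 - k + (k - 1) = n by omega, Nat.cast_sub hk, Nat.cast_sub hk] at h2
  push_cast at h2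
  have h3 : ψ (n + 1) - (1 + δ + (2 - k) * δ ^ 2) * ψ n =
      δ * ((ψ n - ψ (n - k) - k * δ * ψ n) -
        2 * (ψ n - ψ (n + 1 - k) - (k - 1) * δ * ψ n)) := by
    rw [hrec n (by omega)]
    ring
  have h4 := norm_sub_le (ψ n - ψ (n - k) - k * δ * ψ n)
    (2 * (ψ n - ψ (n + 1 - k) - (k - 1) * δ * ψ n))
  rw [norm_mul, Complex.norm_ofNat] at h4
  rw [h3, norm_mul]
  have h5 : 0 ≤ (k : ℝ) * ‖δ‖ ^ 2 := by positivity
  calc _ ≤ ‖δ‖ * (36 * k ^ 2 * ‖δ‖ ^ 2) := by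
        gcongr
        linarith
    _ = _ := by ring

end PerturbedRecurrence

theorem norm_sub_pow_mul_le {ψ : ℕ → ℂ} {r : ℂ} {η : ℝ} {n₀ : ℕ} (hr : ‖r‖ ≤ 1)
    (h : ∀ n, n₀ ≤ n → ‖ψ (n + 1) - r * ψ n‖ ≤ η) (m : ℕ) :
    ‖ψ (n₀ + m) - r ^ m * ψ n₀‖ ≤ m * η := by
  induction m with
  | zero => simp
  | succ m ih =>
    have h1 := h (n₀ + m) (by omega)
    have h2 : ψ (n₀ + m + 1) - r ^ (m + 1) * ψ n₀ =
        (ψ (n₀ + m + 1) - r * ψ (n₀ + m)) + r * (ψ (n₀ + m) - r ^ m * ψ n₀) := by ring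
    rw [← add_assoc, h2]
    refine (norm_add_le _ _).trans ?_
    rw [norm_mul]
    have h3 : ‖r‖ * ‖ψ (n₀ + m) - r ^ m * ψ n₀‖ ≤ 1 * (m * η) := by gcongr
    push_cast
    linarith

/-! ### Characteristic function and its growth factor. -/

/-- The characteristic function of the number of `k`-parts, up to the factor `2 ^ n`. -/
noncomputable def compositionChar (k n : ℕ) (θ : ℝ) : ℂ :=
  compositionSum k n (fun x => Complex.exp (θ * x * Complex.I)) / 2 ^ n

theorem norm_compositionChar_le (k n : ℕ) (θ : ℝ) : ‖compositionChar k n θ‖ ≤ 1 := by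
  have h : ‖compositionSum k n (fun x => Complex.exp (θ * x * Complex.I))‖ ≤ 2 ^ (n - 1) := by
    refine (norm_sum_le _ _).trans ?_
    have (x : ℕ) : ‖Complex.exp (θ * x * Complex.I)‖ = 1 := by
      have := Complex.norm_exp_ofReal_mul_I (θ * x)
      push_cast at this
      exact this
    simp [this, composition_card]
  rw [compositionChar, norm_div, norm_pow, Complex.norm_ofNat, div_le_one (by positivity)]
  exact h.trans (pow_le_pow_right₀ (by norm_num) (by omega))

theorem compositionChar_succ {k n : ℕ} (hk : 1 ≤ k) (hn : k ≤ n) (θ : ℝ) :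
    compositionChar k (n + 1) θ = compositionChar k n θ +
      ((Complex.exp (θ * Complex.I) - 1) / 2 ^ (k + 1)) *
        (2 * compositionChar k (n + 1 - k) θ - compositionChar k (n - k) θ) := by
  have h : (fun x : ℕ => Complex.exp (θ * (x + 1 : ℕ) * Complex.I) -
      Complex.exp (θ * x * Complex.I)) =
      fun x : ℕ => (Complex.exp (θ * Complex.I) - 1) * Complex.exp (θ * x * Complex.I) := by
    ext x
    rw [sub_mul, ← Complex.exp_add]
    push_cast
    ring_nf
  simp only [compositionChar]
  rw [compositionSum_succ_of_le hk hn, h, compositionSum_const_mul, compositionSum_const_mul]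
  obtain ⟨m, rfl⟩ : ∃ m, n = k + m := ⟨n - k, by omega⟩
  rw [show k + m + 1 - k = m + 1 by omega, show k + m - k = m by omega]
  generalize compositionSum (R := ℂ) k _ _ = a
  generalize compositionSum (R := ℂ) k _ _ = b
  generalize compositionSum (R := ℂ) k _ _ = c
  field_simp
  ring

/-- The linear growth rate of the variance of the number of `k`-parts. -/
noncomputable def partsVarRate (k : ℕ) : ℝ := (2 ^ (k + 1) - 2 * k + 3) / 4 ^ (k + 1)

theorem partsVarRate_pos (k : ℕ) : 0 < partsVarRate k := by
  have h : ((k + 1 : ℕ) : ℝ) < 2 ^ (k + 1) := by exact_mod_cast Nat.lt_two_pow_self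
  have h2 : (k : ℝ) ≤ 2 ^ k := by exact_mod_cast Nat.lt_two_pow_self.le
  have : (0 : ℝ) < 2 ^ (k + 1) - 2 * k + 3 := by
    rw [pow_succ]
    linarith
  unfold partsVarRate
  positivity

/-- The one-step growth factor of the characteristic function of the number of `k`-parts, up to
third order. -/
noncomputable def partsFactor (k : ℕ) (θ : ℝ) : ℂ :=
  Complex.exp (θ * Complex.I / 2 ^ (k + 1) - partsVarRate k * θ ^ 2 / 2)

theorem norm_partsFactor_le (k : ℕ) (θ : ℝ) : ‖partsFactor k θ‖ ≤ 1 := by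
  rw [partsFactor, Complex.norm_exp, Real.exp_le_one_iff]
  have h : (θ * Complex.I / 2 ^ (k + 1) - partsVarRate k * θ ^ 2 / 2 : ℂ) =
      ((-(partsVarRate k * θ ^ 2 / 2) : ℝ) : ℂ) + ((θ / 2 ^ (k + 1) : ℝ) : ℂ) * Complex.I := by
    push_cast
    ring
  rw [h, Complex.add_re, Complex.ofReal_re, Complex.re_ofReal_mul, Complex.I_re]
  have := (partsVarRate_pos k).le
  simp only [mul_zero, add_zero, Left.neg_nonpos_iff]
  positivity

open Asymptotics in
theorem partsFactor_sub_isBigO (k : ℕ) :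
    (fun θ : ℝ => partsFactor k θ - (1 + (Complex.exp (θ * Complex.I) - 1) / 2 ^ (k + 1) +
      (2 - k) * ((Complex.exp (θ * Complex.I) - 1) / 2 ^ (k + 1)) ^ 2)) =O[𝓝 0]
      fun θ : ℝ => θ ^ 3 := by
  have hexp : (fun z : ℂ => Complex.exp z - (1 + z + z ^ 2 / 2)) =O[𝓝 0] (· ^ 3) := by
    have := Complex.exp_sub_sum_range_isBigO_pow 3
    simpa [Finset.sum_range_succ] using this
  have hb (f : ℝ → ℂ) (hf : ContinuousAt f 0) : f =O[𝓝 0] fun _ => (1 : ℝ) :=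
    hf.tendsto.isBigO_one ℝ
  have hcube (f : ℝ → ℂ) (hf : ContinuousAt f 0) :
      (fun θ : ℝ => (θ : ℂ) ^ 3 * f θ) =O[𝓝 0] fun θ : ℝ => θ ^ 3 := by
    have h1 : (fun θ : ℝ => (θ : ℂ) ^ 3) =O[𝓝 0] fun θ : ℝ => θ ^ 3 :=
      .of_bound 1 (.of_forall fun θ => by simp)
    simpa using h1.mul (hb f hf)
  have hcomp (g : ℝ → ℂ) (hg : Continuous g) :
      (fun θ : ℝ => Complex.exp (θ * g θ) - (1 + θ * g θ + (θ * g θ) ^ 2 / 2)) =O[𝓝 0]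
        fun θ : ℝ => θ ^ 3 := by
    have ht : Tendsto (fun θ : ℝ => (θ : ℂ) * g θ) (𝓝 0) (𝓝 0) := by
      have : Continuous fun θ : ℝ => (θ : ℂ) * g θ := by fun_prop
      simpa using this.tendsto 0
    refine (hexp.comp_tendsto ht).trans ?_
    refine (hcube (fun θ => g θ ^ 3) (by fun_prop)).congr_left fun θ => ?_
    simp only [Function.comp_apply]
    ring
  set h : ℂ := 1 / 2 ^ (k + 1) with hh
  set v : ℂ := ((partsVarRate k : ℝ) : ℂ) with hv
  -- This value of v makes the θ² coefficients agree: -(h² + v)/2 = -h/2 - (2-k)h².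
  have hvh : v = h + (3 - 2 * k) * h ^ 2 := by
    rw [hv, hh, partsVarRate]
    have h4 : (4 : ℂ) ^ (k + 1) = (2 ^ (k + 1)) ^ 2 := by
      rw [← pow_mul, mul_comm, pow_mul]
      norm_num
    push_cast
    rw [h4]
    field_simp
    ring
  have hA := hcomp (fun θ => h * Complex.I - v * θ / 2) (by fun_prop)
  have hB := hcomp (fun _ => Complex.I) (by fun_prop)
  have hB1 := hB.const_mul_left h
  -- Difference of squares: (X - 1)² - q² = (X - 1 - q)(X - 1 + q), with X = exp(iθ) and q its
  -- Taylor part iθ - θ²/2.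
  have hB2 := hB.mul (hb (fun θ : ℝ => (2 - k) * h ^ 2 *
    (Complex.exp (θ * Complex.I) - 1 + (θ * Complex.I + (θ * Complex.I) ^ 2 / 2)))
    (by fun_prop))
  -- The explicit terms of degree 3 and 4 left over from the squared Taylor polynomials.
  have hC := hcube (fun θ : ℝ => -(h * Complex.I * v) / 2 + v ^ 2 * θ / 8 +
    (2 - k) * h ^ 2 * (Complex.I - θ / 4)) (by fun_prop)
  simp only [mul_one] at hB2
  refine (((hA.sub hB1).sub hB2).add hC).congr_left fun θ => ?_
  have hP : partsFactor k θ = Complex.exp (θ * (h * Complex.I - v * θ / 2)) := by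
    rw [partsFactor, hh]
    congr 1
    ring
  rw [hP]
  have hd : (Complex.exp (θ * Complex.I) - 1) / 2 ^ (k + 1) =
      h * (Complex.exp (θ * Complex.I) - 1) := by
    rw [hh]
    ring
  rw [hd, hvh]
  generalize Complex.exp (θ * Complex.I) = X
  have hI : Complex.I ^ 2 = -1 := Complex.I_sq
  have hI3 : Complex.I ^ 3 = -Complex.I := by rw [pow_succ, hI]; ring
  have hI4 : Complex.I ^ 4 = 1 := Complex.I_pow_four
  ring_nf
  simp only [hI, hI3, hI4]
  ring

theorem exists_norm_compositionChar_sub_le {k : ℕ} (hk : 1 ≤ k) :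
    ∃ C : ℝ, ∀ᶠ θ : ℝ in 𝓝 0, ∀ m : ℕ,
      ‖compositionChar k (3 * k + m) θ - partsFactor k θ ^ m * compositionChar k (3 * k) θ‖ ≤
        m * (C * |θ| ^ 3) := by
  obtain ⟨C, hC⟩ := (partsFactor_sub_isBigO k).bound
  refine ⟨36 * k ^ 2 + C, ?_⟩
  filter_upwards [hC] with θ hθ m
  refine norm_sub_pow_mul_le (ψ := fun n => compositionChar k n θ) (norm_partsFactor_le k θ)
    (fun n hn => ?_) m
  have hδ : ‖(Complex.exp (θ * Complex.I) - 1) / 2 ^ (k + 1)‖ ≤ |θ| := by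
    rw [norm_div, norm_pow, Complex.norm_ofNat]
    refine (div_le_self (norm_nonneg _) (one_le_pow₀ (by norm_num))).trans ?_
    have := Real.norm_exp_I_mul_ofReal_sub_one_le (x := θ)
    rwa [mul_comm, Real.norm_eq_abs] at this
  have h1 := norm_succ_sub_mul_le_of_recurrence (ψ := fun n => compositionChar k n θ) hk
    (fun n => norm_compositionChar_le k n θ) (fun n hn => compositionChar_succ hk hn θ) hn
  set δ := (Complex.exp (θ * Complex.I) - 1) / 2 ^ (k + 1)
  have h2 : compositionChar k (n + 1) θ - partsFactor k θ * compositionChar k n θ =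
      (compositionChar k (n + 1) θ - (1 + δ + (2 - k) * δ ^ 2) * compositionChar k n θ) -
      (partsFactor k θ - (1 + δ + (2 - k) * δ ^ 2)) * compositionChar k n θ := by ring
  rw [norm_pow, Real.norm_eq_abs] at hθ
  rw [h2]
  refine (norm_sub_le _ _).trans ?_
  rw [norm_mul, add_mul (36 * (k : ℝ) ^ 2)]
  have h3 : 36 * (k : ℝ) ^ 2 * ‖δ‖ ^ 3 ≤ 36 * k ^ 2 * |θ| ^ 3 := by gcongr
  refine add_le_add (h1.trans h3) ?_
  calc _ ≤ C * |θ| ^ 3 * 1 := by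
        refine mul_le_mul hθ (norm_compositionChar_le k n θ) (norm_nonneg _) ?_
        exact (norm_nonneg _).trans hθ
    _ = _ := mul_one _

theorem tendsto_compositionChar_zero {k n : ℕ} (hn : 1 ≤ n) :
    Tendsto (compositionChar k n) (𝓝 0) (𝓝 (1 / 2)) := by
  have hc : Continuous (compositionChar k n) := by
    unfold compositionChar compositionSum
    fun_prop
  have h0 : compositionChar k n 0 = 1 / 2 := by
    obtain ⟨m, rfl⟩ : ∃ m, n = m + 1 := ⟨n - 1, by omega⟩
    simp [compositionChar, compositionSum_const, pow_succ]
    field_simp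
  exact h0 ▸ hc.tendsto 0

/-! ### Central limit theorem. -/

/-- The standardized number of `k`-parts of a composition. -/
noncomputable def standardizedParts (k n : ℕ) (c : Composition n) : ℝ :=
  (numParts k c - partsMean n k) / √(partsVar n k)

/-- The factor 2 converts the normalization 2^n into the number 2^(n-1) of compositions. -/
theorem charFun_map_standardizedParts {k n : ℕ} (hn : 1 ≤ n) (s : ℝ) :
    charFun ((uniformComposition n).map (standardizedParts k n)) s =
      2 * Complex.exp (-(s / √(partsVar n k) : ℝ) * partsMean n k * Complex.I) *
        compositionChar k n (s / √(partsVar n k)) := by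
  rw [charFun_apply_real, integral_map (measurable_of_finite _).aemeasurable (by fun_prop)]
  set θ := s / √(partsVar n k) with hθ
  have h (c : Composition n) : Complex.exp (s * standardizedParts k n c * Complex.I) =
      Complex.exp (-θ * partsMean n k * Complex.I) *
        Complex.exp (θ * (c.blocks.count k : ℕ) * Complex.I) := by
    rw [← Complex.exp_add, hθ, standardizedParts, numParts]
    push_cast
    congr 1
    ring
  simp_rw [h]
  rw [integral_const_mul,
    integral_uniformComposition k n (fun x => Complex.exp (θ * x * Complex.I)), compositionChar]
  obtain ⟨m, rfl⟩ : ∃ m, n = m + 1 := ⟨n - 1, by omega⟩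
  rw [Nat.add_sub_cancel, pow_succ, Complex.real_smul]
  push_cast
  field_simp

theorem partsVar_add (k j m : ℕ) :
    partsVar (j + m) k = partsVarRate k * m + partsVar j k := by
  unfold partsVar partsVarRate
  push_cast
  ring

theorem tendsto_partsVar_atTop (k j : ℕ) :
    Tendsto (fun m => partsVar (j + m) k) atTop atTop := by
  simp_rw [partsVar_add]
  exact tendsto_atTop_add_const_right _ _
    (tendsto_natCast_atTop_atTop.const_mul_atTop (partsVarRate_pos k))

theorem tendsto_div_partsVar (k j : ℕ) :
    Tendsto (fun m : ℕ => (m : ℝ) / partsVar (j + m) k) atTop (𝓝 (1 / partsVarRate k)) := by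
  have h1 : Tendsto (fun m : ℕ => partsVarRate k + partsVar j k / m) atTop
      (𝓝 (partsVarRate k + 0)) :=
    tendsto_const_nhds.add (tendsto_const_nhds.div_atTop tendsto_natCast_atTop_atTop)
  rw [add_zero] at h1
  have h2 := h1.inv₀ (partsVarRate_pos k).ne'
  rw [← one_div] at h2
  refine h2.congr' ?_
  filter_upwards [eventually_gt_atTop 0] with m hm
  rw [partsVar_add, ← inv_div]
  field_simp

theorem tendsto_charFun_standardizedParts {k : ℕ} (hk : 1 ≤ k) (s : ℝ) :
    Tendsto (fun n => charFun ((uniformComposition n).map (standardizedParts k n)) s) atTop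
      (𝓝 (Complex.exp (-s ^ 2 / 2))) := by
  rw [← tendsto_add_atTop_iff_nat (3 * k)]
  have h0 (m : ℕ) := charFun_map_standardizedParts (k := k) (show 1 ≤ 3 * k + m by omega) s
  suffices h : Tendsto (fun m => charFun ((uniformComposition (3 * k + m)).map
      (standardizedParts k (3 * k + m))) s) atTop (𝓝 (Complex.exp (-s ^ 2 / 2))) from
    h.congr fun m => by rw [add_comm]
  simp_rw [h0]
  set θ : ℕ → ℝ := fun m => s / √(partsVar (3 * k + m) k) with hθ
  have hV := tendsto_partsVar_atTop k (3 * k)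
  have hθ0 : Tendsto θ atTop (𝓝 0) :=
    tendsto_const_nhds.div_atTop (Real.tendsto_sqrt_atTop.comp hV)
  have hmθ : Tendsto (fun m : ℕ => (m : ℝ) * θ m ^ 2) atTop (𝓝 (s ^ 2 / partsVarRate k)) := by
    have h1 := (tendsto_div_partsVar k (3 * k)).const_mul (s ^ 2)
    rw [mul_one_div] at h1
    refine h1.congr' ?_
    filter_upwards [hV.eventually_gt_atTop 0] with m hm
    rw [hθ]
    simp only [div_pow]
    rw [Real.sq_sqrt hm.le]
    ring
  have hmean (m : ℕ) : partsMean (3 * k + m) k = m / 2 ^ (k + 1) + partsMean (3 * k) k := by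
    unfold partsMean
    push_cast
    ring
  have hmain : Tendsto (fun m : ℕ => 2 * Complex.exp (-(θ m : ℝ) * partsMean (3 * k + m) k *
      Complex.I) * (partsFactor k (θ m) ^ m * compositionChar k (3 * k) (θ m))) atTop
      (𝓝 (Complex.exp (-s ^ 2 / 2))) := by
    have h1 : Tendsto (fun m : ℕ => Complex.exp (-(θ m : ℝ) * (partsMean (3 * k) k : ℝ) *
        Complex.I - (partsVarRate k : ℝ) * ((m * θ m ^ 2 : ℝ) : ℂ) / 2)) atTop
        (𝓝 (Complex.exp (-((0 : ℝ) : ℂ) * (partsMean (3 * k) k : ℝ) *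
        Complex.I - (partsVarRate k : ℝ) * ((s ^ 2 / partsVarRate k : ℝ) : ℂ) / 2))) := by
      have h2 : Tendsto (fun m => (θ m : ℂ)) atTop (𝓝 ((0 : ℝ) : ℂ)) :=
        (Complex.continuous_ofReal.tendsto 0).comp hθ0
      have h3 : Tendsto (fun m : ℕ => ((m * θ m ^ 2 : ℝ) : ℂ)) atTop
          (𝓝 ((s ^ 2 / partsVarRate k : ℝ) : ℂ)) :=
        (Complex.continuous_ofReal.tendsto _).comp hmθ
      exact (((h2.neg.mul_const _).mul_const _).sub ((h3.const_mul _).div_const 2)).cexp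
    have h4 := (h1.const_mul 2).mul
      ((tendsto_compositionChar_zero (k := k) (n := 3 * k) (by omega)).comp hθ0)
    have hlim : 2 * Complex.exp (-((0 : ℝ) : ℂ) * (partsMean (3 * k) k : ℝ) *
        Complex.I - (partsVarRate k : ℝ) * ((s ^ 2 / partsVarRate k : ℝ) : ℂ) / 2) * (1 / 2) =
        Complex.exp (-s ^ 2 / 2) := by
      have hv : ((partsVarRate k : ℝ) : ℂ) ≠ 0 := by exact_mod_cast (partsVarRate_pos k).ne'
      push_cast
      rw [mul_div_cancel₀ _ hv]
      ring_nf
    rw [hlim] at h4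
    refine h4.congr fun m => ?_
    -- The phase of r^m cancels the part of the mean that is linear in m.
    have h5 : Complex.exp (-(θ m : ℝ) * (partsMean (3 * k) k : ℝ) * Complex.I -
        (partsVarRate k : ℝ) * ((m * θ m ^ 2 : ℝ) : ℂ) / 2) =
        Complex.exp (-(θ m : ℝ) * partsMean (3 * k + m) k * Complex.I) *
          partsFactor k (θ m) ^ m := by
      rw [partsFactor, ← Complex.exp_nat_mul, ← Complex.exp_add, hmean]
      congr 1
      push_cast
      ring
    rw [Function.comp_apply, h5]
    ring
  obtain ⟨C, hC⟩ := exists_norm_compositionChar_sub_le hk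
  have herr : Tendsto (fun m : ℕ => 2 * ((m * θ m ^ 2) * (C * |θ m|))) atTop (𝓝 0) := by
    have := (hmθ.mul (hθ0.abs.const_mul C)).const_mul 2
    simpa using this
  have hdiff : Tendsto (fun m : ℕ => 2 * Complex.exp (-(θ m : ℝ) * partsMean (3 * k + m) k *
      Complex.I) * (compositionChar k (3 * k + m) (θ m) -
        partsFactor k (θ m) ^ m * compositionChar k (3 * k) (θ m))) atTop (𝓝 0) := by
    refine squeeze_zero_norm' ?_ herr
    filter_upwards [hθ0.eventually hC] with m hm
    have h1 : ‖Complex.exp (-(θ m : ℝ) * partsMean (3 * k + m) k * Complex.I)‖ = 1 := by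
      have := Complex.norm_exp_ofReal_mul_I (-(θ m) * partsMean (3 * k + m) k)
      push_cast at this
      exact this
    rw [norm_mul, norm_mul, h1, Complex.norm_ofNat, mul_one]
    have h2 := hm m
    rw [pow_succ |θ m| 2, sq_abs] at h2
    linarith
  have := hdiff.add hmain
  rw [zero_add] at this
  exact this.congr fun m => by ring

theorem gaussianReal_real_Iio (t : ℝ) :
    (gaussianReal 0 1).real (Set.Iio t) =
      1 / √(2 * Real.pi) * ∫ x in Set.Iic t, Real.exp (-x ^ 2 / 2) := by
  rw [measureReal_def, gaussianReal_apply_eq_integral 0 one_ne_zero, ENNReal.toReal_ofReal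
    (integral_nonneg fun x => gaussianPDFReal_nonneg 0 1 x), ← integral_Iic_eq_integral_Iio,
    ← integral_const_mul]
  simp [gaussianPDFReal]

theorem tendsto_standardizedParts {k : ℕ} (hk : 1 ≤ k) (t : ℝ) :
    Tendsto (fun n => (uniformComposition n).real {c | standardizedParts k n c < t}) atTop
      (𝓝 (1 / √(2 * Real.pi) * ∫ x in Set.Iic t, Real.exp (-x ^ 2 / 2))) := by
  have hm (n : ℕ) : Measurable (standardizedParts k n) := measurable_of_finite _
  have hp (n : ℕ) : IsProbabilityMeasure ((uniformComposition n).map (standardizedParts k n)) :=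
    Measure.isProbabilityMeasure_map (hm n).aemeasurable
  let P (n : ℕ) : ProbabilityMeasure ℝ := ⟨_, hp n⟩
  let G : ProbabilityMeasure ℝ := ⟨gaussianReal 0 1, inferInstance⟩
  have hPG : Tendsto P atTop (𝓝 G) := by
    refine ProbabilityMeasure.tendsto_iff_tendsto_charFun.2 fun s => ?_
    have h := tendsto_charFun_standardizedParts hk s
    simpa [P, G, charFun_gaussianReal, neg_div] using h
  have hfr : (G : Measure ℝ) (frontier (Set.Iio t)) = 0 := by
    have := nullSingletonClass_gaussianReal (μ := 0) (v := 1) one_ne_zero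
    rw [frontier_Iio]
    exact measure_singleton (μ := gaussianReal 0 1) t
  have h := ProbabilityMeasure.tendsto_measure_of_null_frontier_of_tendsto' hPG hfr
  rw [← gaussianReal_real_Iio]
  refine ((ENNReal.tendsto_toReal (measure_ne_top _ _)).comp h).congr fun n => ?_
  exact congrArg ENNReal.toReal (Measure.map_apply (hm n) measurableSet_Iio)

theorem mainTheorem6 (k : ℕ) (hk : 1 ≤ k) :
    (∀ n : ℕ, k < n → ∫ c, numParts k c ∂(uniformComposition n) = partsMean n k) ∧
    (∀ n : ℕ, 2 * k < n →
      variance (fun c : Composition n => numParts k c) (uniformComposition n) = partsVar n k) ∧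
    (∀ t : ℝ,
      Tendsto
        (fun n : ℕ => (uniformComposition n).real
          {c : Composition n | (numParts k c - partsMean n k) / √(partsVar n k) < t})
        atTop
        (𝓝 (1 / √(2 * Real.pi) * ∫ x in Set.Iic t, Real.exp (-x ^ 2 / 2)))) := by
  exact ⟨fun _ hn => integral_numParts hk hn, fun _ hn => variance_numParts hk hn,
    tendsto_standardizedParts hk⟩
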